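/- There is an absolute constant $C>0$ such that the following holds for every $p\in[1,\infty]$, all integers $r\ge 16$ and $m\ge 1$, and every $\sigma\ge 0$. Put $T=2r$. Let $\mathscr H_r$ be the space of length-$r$ FIR filters $G(z)=\sum_{k=0}^{r-1} g_k z^{-k}$ with $g=(g_k)\in\mathbb C^r$ (given the Borel $\sigma$-algebra of $\mathbb C^r$), let $\mathscr H_r^{\mathbb R}\subset\mathscr H_r$ be the filters with real coefficients, and let $\|G\|_\infty=\sup_{|z|=1}|G(z)|$. For $u\in\mathbb C^T$ let $(g*u)_k=\sum_{0\le j\le\min(k,r-1)} g_j u_{k-j}$, $0\le k\le T-1$. (Real setting.) Fix inputs $u_1,\dots,u_m\in\mathbb R^T$ with $\|u_i\|_p\le 1$ for all $i$. For $G\in\mathscr H_r^{\mathbb R}$ let $Y=(Y_1,\dots,Y_m)$ with $Y_i=g*u_i+\xi_i$, where the $\xi_i\sim N(0,\sigma^2 I_T)$ are independent. Then $$\inf_{\widehat G}\ \sup_{G\in\mathscr H_r^{\mathbb R}} \mathbb E\,\|\widehat G(Y)-G\|_\infty\ \ge\ C\sigma\sqrt{\frac{r^{2/\max(p,2)}\log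 r}{m}},$$ where the infimum is over all measurable maps $\widehat G:(\mathbb R^T)^m\to\mathscr H_r$ (and $2/\max(p,2)=0$ when $p=\infty$). (Complex setting.) Fix inputs $u_1,\dots,u_m\in\mathbb C^T$ with $\|u_i\|_p\le 1$ for all $i$. For $G\in\mathscr H_r$ let $Y_i=g*u_i+\xi_i$, where the real and imaginary parts of all the coordinates of $\xi_1,\dots,\xi_m$ are independent $N(0,\sigma^2)$ variables. Then, with the same constant $C$, $$\inf_{\widehat G}\ \sup_{G\in\mathscr H_r} \mathbb E\,\|\widehat G(Y)-G\|_\infty\ \ge\ C\sigma\sqrt{\frac{r^{2/\max(p,2)}\log r}{m}},$$ where the infimum is over all measurable maps $\widehat G:(\mathbb C^T)^m\to\mathscr H_r$. -/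

import Mathlib

open MeasureTheory ProbabilityTheory
open scoped NNReal ENNReal

noncomputable section

namespace FIRIdent

/-- A length-`r` FIR filter `G(z) = ∑_{k<r} g_k z^{-k}`, given by its coefficients `g ∈ ℂ^r`
(with the Borel σ-algebra of `ℂ^r`). -/
abbrev FIRFilter (r : ℕ) : Type := Fin r → ℂ

/-- The transfer function `G(z) = ∑_{k<r} g_k z^{-k}`. -/
def transfer {r : ℕ} (g : FIRFilter r) (z : ℂ) : ℂ :=
  ∑ k : Fin r, g k * (z ^ (k : ℕ))⁻¹

/-- The `H∞` norm: the supremum of `|G(z)|` over the unit circle. -/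
def hinfNorm {r : ℕ} (g : FIRFilter r) : ℝ≥0∞ :=
  ⨆ z : Circle, ‖transfer g (z : ℂ)‖ₑ

/-- The real filters among the FIR filters. -/
def ofRealFilter {r : ℕ} (g : Fin r → ℝ) : FIRFilter r := fun k => (g k : ℂ)

/-- The first `T` outputs `(g * u)_k = ∑_{j + l = k} g_j u_l`, `k < T`, of the filter with
impulse response `g` (zero from index `r` on) on the input `u` of length `T`. -/
def conv {R : Type*} [Semiring R] {r T : ℕ} (g : Fin r → R) (u : Fin T → R) : Fin T → R :=
  fun k => ∑ j : Fin r, ∑ l : Fin T, if (j : ℕ) + (l : ℕ) = (k : ℕ) then g j * u l else 0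

/-- The law of `m` independent noisy real measurements `Y_i = (g * u_i) + ξ_i`,
`ξ_i ∼ N(0, σ² I_T)`. -/
def realLaw {r T m : ℕ} (σ : ℝ≥0) (u : Fin m → Fin T → ℝ) (g : Fin r → ℝ) :
    Measure (Fin m → Fin T → ℝ) :=
  Measure.pi fun i => Measure.pi fun t => gaussianReal (conv g (u i) t) (σ ^ 2)

/-- The law of `μ + √v (w₁ + i w₂)` with `w₁, w₂` independent standard real Gaussians. -/
def complexGaussian (μ : ℂ) (v : ℝ≥0) : Measure ℂ :=
  ((gaussianReal μ.re v).prod (gaussianReal μ.im v)).map fun x => (⟨x.1, x.2⟩ : ℂ)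

/-- The law of `m` independent noisy complex measurements `Y_i = (g * u_i) + ξ_i`, where the real
and imaginary parts of the coordinates of the `ξ_i` are independent `N(0, σ²)`. -/
def complexLaw {r T m : ℕ} (σ : ℝ≥0) (u : Fin m → Fin T → ℂ) (g : FIRFilter r) :
    Measure (Fin m → Fin T → ℂ) :=
  Measure.pi fun i => Measure.pi fun t => complexGaussian (conv g (u i) t) (σ ^ 2)

/-- `inf_Ĝ sup_G E ‖Ĝ - G‖_∞` for real inputs, real data and real filters `G`. The infimum is over
all measurable maps from the data to length-`r` FIR filters, complex coefficients being allowed. -/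
def realMinimaxRisk (r : ℕ) {T m : ℕ} (σ : ℝ≥0) (u : Fin m → Fin T → ℝ) : ℝ≥0∞ :=
  ⨅ (Ghat : (Fin m → Fin T → ℝ) → FIRFilter r) (_ : Measurable Ghat),
    ⨆ g : Fin r → ℝ, ∫⁻ Y, hinfNorm (Ghat Y - ofRealFilter g) ∂(realLaw σ u g)

/-- `inf_Ĝ sup_G E ‖Ĝ - G‖_∞` for complex inputs, complex data and complex filters `G`. -/
def complexMinimaxRisk (r : ℕ) {T m : ℕ} (σ : ℝ≥0) (u : Fin m → Fin T → ℂ) : ℝ≥0∞ :=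
  ⨅ (Ghat : (Fin m → Fin T → ℂ) → FIRFilter r) (_ : Measurable Ghat),
    ⨆ g : FIRFilter r, ∫⁻ Y, hinfNorm (Ghat Y - g) ∂(complexLaw σ u g)

/-- `σ √(r^{2 / max(p,2)} log r / m)`; the exponent is `0` for `p = ∞`. -/
def rate (p : ℝ≥0∞) (σ : ℝ≥0) (r m : ℕ) : ℝ :=
  (σ : ℝ) * Real.sqrt ((r : ℝ) ^ (2 / max p 2).toReal * Real.log r / m)

end FIRIdent

end

/-! Testing among about `r` cosine filters `a cos(2πkj/r)`, `0 < k < r/2`. At the root of unity of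
frequency `k`, the filter of frequency `k` has value `a r / 2` and the others vanish
(`transfer_cosFilter`), so the filters are `a r / 2`-separated in `H∞`. By Parseval the output
energy, summed over all `r` frequencies, is at most `a² r²` times the input energy, so by Markov's
inequality a fixed fraction of the frequencies have energy of the average order
(`exists_frequencies_energy_le`).

The likelihood ratio against the zero filter has second moment at most `exp (energy / σ²)`. If every
hypothesis were recognised with probability above `3/4`, disjointness of the recognition events
would force this moment to exceed a multiple of their number (`exists_measure_le_of_sqDominated`). A
moment of `r^(1/4)` is thus harmless, which allows energy `σ² log r / 4`: this is the source of the
logarithm. The `ℓ^p` constraint enters only through the energy bound `sum_norm_sq_le_of_lp_norm_le`.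
-/

namespace FIRIdent

/-! ### Second-moment domination of measures -/

section SqDominated

variable {α β : Type*} [MeasurableSpace α] [MeasurableSpace β]

/-- `P` is dominated by `Q` in the `L²` sense with constant `K`. For `P ≪ Q` this says that the
second moment of `dP/dQ` under `Q` is at most `K`. -/
def SqDominated (K : ℝ≥0∞) (P Q : Measure α) : Prop :=
  ∀ f : α → ℝ≥0∞, Measurable f → (∫⁻ x, f x ∂P) ^ 2 ≤ K * ∫⁻ x, f x ^ 2 ∂Q

theorem SqDominated.measure_sq_le {K : ℝ≥0∞} {P Q : Measure α} (h : SqDominated K P Q)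
    {B : Set α} (hB : MeasurableSet B) : P B ^ 2 ≤ K * Q B := by
  have h1 := h (B.indicator 1) (measurable_one.indicator hB)
  have h2 : ∀ x, (B.indicator (1 : α → ℝ≥0∞) x) ^ 2 = B.indicator 1 x := by
    intro x
    by_cases hx : x ∈ B <;> simp [hx]
  simp only [h2, lintegral_indicator_one hB] at h1
  exact h1

theorem SqDominated.mono {K L : ℝ≥0∞} {P Q : Measure α} (h : SqDominated K P Q) (hKL : K ≤ L) :
    SqDominated L P Q := fun f hf => (h f hf).trans (by gcongr)

theorem SqDominated.map {K : ℝ≥0∞} {P Q : Measure α} (h : SqDominated K P Q)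
    {φ : α → β} (hφ : Measurable φ) : SqDominated K (P.map φ) (Q.map φ) := by
  intro f hf
  rw [lintegral_map hf hφ, lintegral_map (hf.pow_const 2) hφ]
  exact h _ (hf.comp hφ)

/-- The test-function form tensorizes by Tonelli alone: one bound applies to the inner integral as a
function of `x`, the other on each fibre. No densities are needed. -/
theorem SqDominated.prod {K L : ℝ≥0∞} {P Q : Measure α} {P' Q' : Measure β} [SFinite P]
    [SFinite P'] [SFinite Q] [SFinite Q']
    (h : SqDominated K P Q) (h' : SqDominated L P' Q') :
    SqDominated (K * L) (P.prod P') (Q.prod Q') := by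
  intro f hf
  rw [lintegral_prod _ hf.aemeasurable, lintegral_prod _ (hf.pow_const 2).aemeasurable]
  calc (∫⁻ x, ∫⁻ y, f (x, y) ∂P' ∂P) ^ 2
      ≤ K * ∫⁻ x, (∫⁻ y, f (x, y) ∂P') ^ 2 ∂Q := h _ hf.lintegral_prod_right'
    _ ≤ K * ∫⁻ x, L * ∫⁻ y, f (x, y) ^ 2 ∂Q' ∂Q := by
        gcongr with x
        exact h' _ (hf.comp measurable_prodMk_left)
    _ = K * L * ∫⁻ x, ∫⁻ y, f (x, y) ^ 2 ∂Q' ∂Q := by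
        rw [lintegral_const_mul _ (hf.pow_const 2).lintegral_prod_right', mul_assoc]

theorem SqDominated.pi {n : ℕ} {K : Fin n → ℝ≥0∞} {P Q : Fin n → Measure α}
    [∀ i, SigmaFinite (P i)] [∀ i, SigmaFinite (Q i)] (h : ∀ i, SqDominated (K i) (P i) (Q i)) :
    SqDominated (∏ i, K i) (Measure.pi P) (Measure.pi Q) := by
  induction n with
  | zero =>
    intro f hf
    rw [Measure.pi_of_empty P, Measure.pi_of_empty Q, lintegral_dirac' _ hf,
      lintegral_dirac' _ (hf.pow_const 2)]
    simp
  | succ n ih =>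
    have hP := (measurePreserving_piFinSuccAbove P 0).symm
    have hQ := (measurePreserving_piFinSuccAbove Q 0).symm
    have key := ((h 0).prod (ih fun i => h (Fin.succAbove 0 i))).map hP.measurable
    rw [hP.map_eq, hQ.map_eq] at key
    rw [Fin.prod_univ_succAbove K 0]
    exact key

theorem lintegral_mul_sq_le (μ : Measure α) {f g : α → ℝ≥0∞} (hf : Measurable f)
    (hg : Measurable g) :
    (∫⁻ x, f x * g x ∂μ) ^ 2 ≤ (∫⁻ x, f x ^ 2 ∂μ) * ∫⁻ x, g x ^ 2 ∂μ := by
  have h := ENNReal.lintegral_mul_le_Lp_mul_Lq μ Real.HolderConjugate.two_two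
    hf.aemeasurable hg.aemeasurable
  simp only [Pi.mul_apply, ENNReal.rpow_two] at h
  calc (∫⁻ x, f x * g x ∂μ) ^ 2
      ≤ ((∫⁻ x, f x ^ 2 ∂μ) ^ (1 / 2 : ℝ) * (∫⁻ x, g x ^ 2 ∂μ) ^ (1 / 2 : ℝ)) ^ 2 := by gcongr
    _ = (∫⁻ x, f x ^ 2 ∂μ) * ∫⁻ x, g x ^ 2 ∂μ := by
        rw [mul_pow, ← ENNReal.rpow_two, ← ENNReal.rpow_two, ← ENNReal.rpow_mul,
          ← ENNReal.rpow_mul]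
        norm_num

end SqDominated

/-! ### Gaussian measurements against pure noise -/

/-- Completes the square: `2(x - μ)² = (x - 2μ)² + x² - 2μ²`. Hence the squared density over the
centred one is a multiple of a Gaussian density, whose integral is known. -/
theorem gaussianPDFReal_sq_eq (μ : ℝ) (v : ℝ≥0) (hv : v ≠ 0) (x : ℝ) :
    gaussianPDFReal μ v x ^ 2 =
      Real.exp (μ ^ 2 / v) * gaussianPDFReal (2 * μ) v x * gaussianPDFReal 0 v x := by
  have hv' : (v : ℝ) ≠ 0 := by exact_mod_cast hv
  have e : Real.exp (-(x - μ) ^ 2 / (2 * v)) ^ 2 = Real.exp (μ ^ 2 / v) *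
      Real.exp (-(x - 2 * μ) ^ 2 / (2 * v)) * Real.exp (-(x - 0) ^ 2 / (2 * v)) := by
    rw [← Real.exp_nat_mul, ← Real.exp_add, ← Real.exp_add]
    congr 1
    field_simp
    push_cast
    ring
  simp only [gaussianPDFReal, mul_pow]
  rw [e]
  ring

theorem sqDominated_gaussianReal (μ : ℝ) {v : ℝ≥0} (hv : v ≠ 0) :
    SqDominated (ENNReal.ofReal (Real.exp (μ ^ 2 / v))) (gaussianReal μ v) (gaussianReal 0 v) := by
  intro f hf
  have h0 := fun x => gaussianPDFReal_pos 0 v x hv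
  rw [gaussianReal_of_var_ne_zero _ hv, gaussianReal_of_var_ne_zero _ hv,
    lintegral_withDensity_eq_lintegral_mul _ (measurable_gaussianPDF _ _) hf,
    lintegral_withDensity_eq_lintegral_mul _ (measurable_gaussianPDF _ _) (hf.pow_const 2)]
  have hm := measurable_gaussianPDFReal 0 v
  have hm' := measurable_gaussianPDFReal μ v
  -- Cauchy–Schwarz for the splitting `p_μ f = (p_μ / √p₀) · (√p₀ f)`.
  have key := lintegral_mul_sq_le volume
    (f := fun x => ENNReal.ofReal (gaussianPDFReal μ v x / √(gaussianPDFReal 0 v x)))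
    (g := fun x => ENNReal.ofReal (√(gaussianPDFReal 0 v x)) * f x)
    (by fun_prop) (by fun_prop)
  have e1 : ∀ x, ENNReal.ofReal (gaussianPDFReal μ v x / √(gaussianPDFReal 0 v x)) *
      (ENNReal.ofReal (√(gaussianPDFReal 0 v x)) * f x) = gaussianPDF μ v x * f x := by
    intro x
    rw [← mul_assoc, ← ENNReal.ofReal_mul
      (div_nonneg (gaussianPDFReal_nonneg _ _ _) (Real.sqrt_nonneg _)),
      div_mul_cancel₀ _ (Real.sqrt_pos.2 (h0 x)).ne']
    rfl
  have e2 : ∀ x, ENNReal.ofReal (gaussianPDFReal μ v x / √(gaussianPDFReal 0 v x)) ^ 2 =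
      ENNReal.ofReal (Real.exp (μ ^ 2 / v)) * gaussianPDF (2 * μ) v x := by
    intro x
    rw [← ENNReal.ofReal_pow (div_nonneg (gaussianPDFReal_nonneg _ _ _) (Real.sqrt_nonneg _)),
      div_pow, Real.sq_sqrt (h0 x).le, gaussianPDFReal_sq_eq μ v hv,
      mul_div_cancel_right₀ _ (h0 x).ne', ENNReal.ofReal_mul (Real.exp_pos _).le]
    rfl
  have e3 : ∀ x, (ENNReal.ofReal (√(gaussianPDFReal 0 v x)) * f x) ^ 2 =
      gaussianPDF 0 v x * f x ^ 2 := by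
    intro x
    rw [mul_pow, ← ENNReal.ofReal_pow (Real.sqrt_nonneg _), Real.sq_sqrt (h0 x).le]
    rfl
  simp only [e1, e2, e3] at key
  rw [lintegral_const_mul _ (measurable_gaussianPDF _ _), lintegral_gaussianPDF_eq_one _ hv,
    mul_one] at key
  exact key

instance (μ : ℂ) (v : ℝ≥0) : IsProbabilityMeasure (complexGaussian μ v) :=
  Measure.isProbabilityMeasure_map
    (Complex.measurableEquivRealProd.symm.measurable.aemeasurable)

theorem sqDominated_complexGaussian (μ : ℂ) {v : ℝ≥0} (hv : v ≠ 0) :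
    SqDominated (ENNReal.ofReal (Real.exp (‖μ‖ ^ 2 / v))) (complexGaussian μ v)
      (complexGaussian 0 v) := by
  have h := ((sqDominated_gaussianReal μ.re hv).prod (sqDominated_gaussianReal μ.im hv)).map
    Complex.measurableEquivRealProd.symm.measurable
  rw [← ENNReal.ofReal_mul (Real.exp_pos _).le, ← Real.exp_add, ← add_div] at h
  rw [Complex.sq_norm, Complex.normSq_apply, ← sq, ← sq]
  exact h

theorem prod_ofReal_exp {ι : Type*} (s : Finset ι) (f : ι → ℝ) :
    ∏ i ∈ s, ENNReal.ofReal (Real.exp (f i)) = ENNReal.ofReal (Real.exp (∑ i ∈ s, f i)) := by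
  rw [← ENNReal.ofReal_prod_of_nonneg fun i _ => (Real.exp_pos _).le, Real.exp_sum]

theorem conv_zero_left {R : Type*} [Semiring R] {r T : ℕ} (u : Fin T → R) :
    conv (0 : Fin r → R) u = 0 := by
  ext k
  simp [conv]

instance {r T m : ℕ} (σ : ℝ≥0) (u : Fin m → Fin T → ℝ) (g : Fin r → ℝ) :
    IsProbabilityMeasure (realLaw σ u g) := by
  unfold realLaw
  infer_instance

instance {r T m : ℕ} (σ : ℝ≥0) (u : Fin m → Fin T → ℂ) (g : FIRFilter r) :
    IsProbabilityMeasure (complexLaw σ u g) := by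
  unfold complexLaw
  infer_instance

theorem sqDominated_realLaw {r T m : ℕ} {σ : ℝ≥0} (hσ : σ ≠ 0) (u : Fin m → Fin T → ℝ)
    (g : Fin r → ℝ) :
    SqDominated (ENNReal.ofReal (Real.exp ((∑ i, ∑ t, ‖conv g (u i) t‖ ^ 2) / σ ^ 2)))
      (realLaw σ u g) (realLaw σ u (0 : Fin r → ℝ)) := by
  have hv : σ ^ 2 ≠ 0 := pow_ne_zero 2 hσ
  have h := SqDominated.pi fun i => SqDominated.pi fun t =>
    sqDominated_gaussianReal (conv g (u i) t) hv
  simp only [prod_ofReal_exp, ← Finset.sum_div, NNReal.coe_pow] at h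
  simpa [realLaw, conv_zero_left] using h

theorem sqDominated_complexLaw {r T m : ℕ} {σ : ℝ≥0} (hσ : σ ≠ 0) (u : Fin m → Fin T → ℂ)
    (g : FIRFilter r) :
    SqDominated (ENNReal.ofReal (Real.exp ((∑ i, ∑ t, ‖conv g (u i) t‖ ^ 2) / σ ^ 2)))
      (complexLaw σ u g) (complexLaw σ u (0 : FIRFilter r)) := by
  have hv : σ ^ 2 ≠ 0 := pow_ne_zero 2 hσ
  have h := SqDominated.pi fun i => SqDominated.pi fun t =>
    sqDominated_complexGaussian (conv g (u i) t) hv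
  simp only [prod_ofReal_exp, ← Finset.sum_div, NNReal.coe_pow] at h
  simpa [complexLaw, conv_zero_left] using h

/-! ### From disjoint events to a risk bound -/

/-- If many laws are dominated by a common one and the sets `B k` are disjoint, then some `B k`
has probability at most `3/4` under `P k`. -/
theorem exists_measure_le_of_sqDominated {Ω ι : Type*} [MeasurableSpace Ω] (S : Finset ι)
    (P : ι → Measure Ω) (Q : Measure Ω) [IsProbabilityMeasure Q] {K : ℝ≥0∞}
    (hP : ∀ k ∈ S, SqDominated K (P k) Q) {B : ι → Set Ω} (hB : ∀ k ∈ S, MeasurableSet (B k))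
    (hdisj : (S : Set ι).PairwiseDisjoint B) (hS : S.Nonempty) (hK : 16 * K ≤ 9 * S.card) :
    ∃ k ∈ S, P k (B k) ≤ 3 / 4 := by
  by_contra! hcon
  have hlt : ∀ k ∈ S, (9 / 16 : ℝ≥0∞) < K * Q (B k) := by
    intro k hk
    refine lt_of_lt_of_le ?_ ((hP k hk).measure_sq_le (hB k hk))
    have h : (3 / 4 : ℝ≥0∞) ^ 2 = 9 / 16 := by
      rw [ENNReal.div_eq_inv_mul, ENNReal.div_eq_inv_mul, mul_pow, ← ENNReal.inv_pow]
      norm_num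
    rw [← h]
    exact ENNReal.pow_lt_pow_left two_ne_zero (hcon k hk)
  have hsum : ∑ k ∈ S, (9 / 16 : ℝ≥0∞) < ∑ k ∈ S, K * Q (B k) :=
    ENNReal.sum_lt_sum_of_nonempty hS hlt
  rw [Finset.sum_const, nsmul_eq_mul, ← Finset.mul_sum,
    ← measure_biUnion_finset hdisj hB] at hsum
  -- Disjointness is used here: all the `Q (B k)` together share total mass at most one.
  have hle : K * Q (⋃ k ∈ S, B k) ≤ K := by
    simpa using mul_le_mul_right (prob_le_one (μ := Q) (s := ⋃ k ∈ S, B k)) K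
  have h2 : (S.card : ℝ≥0∞) * (9 / 16) < K := hsum.trans_le hle
  have h3 : (16 : ℝ≥0∞) * ((S.card : ℝ≥0∞) * (9 / 16)) = 9 * S.card := by
    rw [mul_left_comm, ENNReal.mul_div_cancel (by norm_num) (by norm_num), mul_comm]
  have h4 := ENNReal.mul_lt_mul_right (a := 16) (by norm_num) (by norm_num) h2
  rw [h3] at h4
  exact absurd hK (not_le.2 h4)

/-- If `B` has probability at most `3/4` and the loss is at least `δ` off `B`, then the risk is at
least `δ / 4`. -/
theorem mul_le_lintegral_of_measure_le {Ω : Type*} [MeasurableSpace Ω] (P : Measure Ω)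
    [IsProbabilityMeasure P] {B : Set Ω} (hB : MeasurableSet B) (hPB : P B ≤ 3 / 4)
    {δ : ℝ≥0∞} {d : Ω → ℝ≥0∞} (hd : ∀ ω ∉ B, δ ≤ d ω) : δ * 4⁻¹ ≤ ∫⁻ ω, d ω ∂P := by
  have h1 : (4 : ℝ≥0∞)⁻¹ ≤ P Bᶜ := by
    rw [prob_compl_eq_one_sub hB]
    refine le_trans ?_ (tsub_le_tsub_left hPB 1)
    refine ENNReal.le_sub_of_add_le_left (ENNReal.div_ne_top (by norm_num) (by norm_num)) ?_
    rw [← one_div, ENNReal.div_add_div_same]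
    norm_num
  calc δ * 4⁻¹ ≤ δ * P Bᶜ := by gcongr
    _ = ∫⁻ _ in Bᶜ, δ ∂P := by rw [setLIntegral_const]
    _ ≤ ∫⁻ ω in Bᶜ, d ω ∂P := setLIntegral_mono' hB.compl hd
    _ ≤ ∫⁻ ω, d ω ∂P := setLIntegral_le_lintegral _ _

/-! ### Cosine filters and their output energy -/

theorem sum_zpow_pow_of_isPrimitiveRoot {ζ : ℂ} {r : ℕ} (hζ : IsPrimitiveRoot ζ r) (n : ℤ) :
    ∑ j : Fin r, (ζ ^ n) ^ (j : ℕ) = if (r : ℤ) ∣ n then (r : ℂ) else 0 := by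
  rw [Fin.sum_univ_eq_sum_range (fun j => (ζ ^ n) ^ j) r]
  split_ifs with h
  · rw [(hζ.zpow_eq_one_iff_dvd n).2 h]
    simp
  · have hne : ζ ^ n ≠ 1 := fun h1 => h ((hζ.zpow_eq_one_iff_dvd n).1 h1)
    rw [geom_sum_eq hne, ← zpow_natCast, ← zpow_mul, mul_comm, zpow_mul, zpow_natCast,
      hζ.pow_eq_one, one_zpow, sub_self, zero_div]

/-- Parseval's identity for the discrete Fourier transform of length `r`. -/
theorem sum_norm_sq_fourier {ζ : ℂ} {r : ℕ} (hr : r ≠ 0) (hζ : IsPrimitiveRoot ζ r)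
    (x : Fin r → ℂ) :
    ∑ k : Fin r, ‖∑ j : Fin r, ζ ^ ((k : ℕ) * (j : ℕ)) * x j‖ ^ 2 = r * ∑ j, ‖x j‖ ^ 2 := by
  have hζ0 : ζ ≠ 0 := hζ.ne_zero hr
  have hconj : (starRingEnd ℂ) ζ = ζ⁻¹ := by
    rw [Complex.inv_def, Complex.normSq_eq_norm_sq, hζ.norm'_eq_one hr]
    simp
  have key : ∀ k : Fin r, (‖∑ j : Fin r, ζ ^ ((k : ℕ) * (j : ℕ)) * x j‖ ^ 2 : ℂ) =
      ∑ j : Fin r, ∑ l : Fin r, x j * (starRingEnd ℂ) (x l) *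
        (ζ ^ ((j : ℤ) - (l : ℤ))) ^ (k : ℕ) := by
    intro k
    rw [← Complex.mul_conj', map_sum, Finset.sum_mul_sum]
    refine Finset.sum_congr rfl fun j _ => Finset.sum_congr rfl fun l _ => ?_
    rw [map_mul, map_pow, hconj, zpow_sub₀ hζ0, div_pow, zpow_natCast, zpow_natCast, ← pow_mul,
      ← pow_mul, mul_comm (j : ℕ), mul_comm (l : ℕ), inv_pow]
    ring
  have hdvd : ∀ j l : Fin r, ((r : ℤ) ∣ (j : ℤ) - (l : ℤ)) ↔ j = l := by
    intro j l
    refine ⟨fun h => ?_, fun h => by simp [h]⟩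
    have hj := j.isLt
    have hl := l.isLt
    have h0 := Int.eq_zero_of_abs_lt_dvd h (by rw [abs_lt]; omega)
    exact Fin.ext (by omega)
  have hC : (∑ k : Fin r, (‖∑ j : Fin r, ζ ^ ((k : ℕ) * (j : ℕ)) * x j‖ ^ 2 : ℂ)) =
      r * ∑ j, (‖x j‖ ^ 2 : ℂ) := by
    simp_rw [key]
    rw [Finset.sum_comm, Finset.mul_sum]
    refine Finset.sum_congr rfl fun j _ => ?_
    rw [Finset.sum_comm]
    simp_rw [← Finset.mul_sum, sum_zpow_pow_of_isPrimitiveRoot hζ, hdvd, ← Complex.mul_conj']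
    simp [mul_comm]
  exact_mod_cast hC

/-- The cosine filter `g_j = cos (2π k j / r)`. -/
noncomputable def cosFilter (r k : ℕ) (j : Fin r) : ℝ :=
  (Complex.exp (2 * Real.pi * Complex.I / r) ^ (k * (j : ℕ))).re

theorem cosFilter_eq {r : ℕ} (hr : r ≠ 0) (k : ℕ) (j : Fin r) :
    (cosFilter r k j : ℂ) =
      (Complex.exp (2 * Real.pi * Complex.I / r) ^ (k * (j : ℕ)) +
        (Complex.exp (2 * Real.pi * Complex.I / r))⁻¹ ^ (k * (j : ℕ))) / 2 := by
  have hζ := Complex.isPrimitiveRoot_exp r hr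
  set ζ := Complex.exp (2 * Real.pi * Complex.I / r)
  have hconj : (starRingEnd ℂ) ζ = ζ⁻¹ := by
    rw [Complex.inv_def, Complex.normSq_eq_norm_sq, hζ.norm'_eq_one hr]
    simp
  rw [cosFilter, Complex.re_eq_add_conj, map_pow, hconj]

/-- A cosine is the mean of the characters of `ζ` and `ζ⁻¹`; Parseval holds for both primitive
roots, and the squared norm is convex. -/
theorem sum_norm_sq_cosFilter_le {r : ℕ} (hr : r ≠ 0) (x : Fin r → ℂ) :
    ∑ k : Fin r, ‖∑ j : Fin r, (cosFilter r k j : ℂ) * x j‖ ^ 2 ≤ r * ∑ j, ‖x j‖ ^ 2 := by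
  have hζ := Complex.isPrimitiveRoot_exp r hr
  have h1 := sum_norm_sq_fourier hr hζ x
  have h2 := sum_norm_sq_fourier hr hζ.inv x
  simp_rw [cosFilter_eq hr]
  set ζ := Complex.exp (2 * Real.pi * Complex.I / r)
  have hk : ∀ k : Fin r,
      ‖∑ j : Fin r, (ζ ^ ((k : ℕ) * (j : ℕ)) + ζ⁻¹ ^ ((k : ℕ) * (j : ℕ))) / 2 * x j‖ ^ 2 ≤
        (‖∑ j : Fin r, ζ ^ ((k : ℕ) * (j : ℕ)) * x j‖ ^ 2 +
          ‖∑ j : Fin r, ζ⁻¹ ^ ((k : ℕ) * (j : ℕ)) * x j‖ ^ 2) / 2 := by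
    intro k
    set a := ∑ j : Fin r, ζ ^ ((k : ℕ) * (j : ℕ)) * x j with ha
    set b := ∑ j : Fin r, ζ⁻¹ ^ ((k : ℕ) * (j : ℕ)) * x j with hb
    have hab : ∑ j : Fin r, (ζ ^ ((k : ℕ) * (j : ℕ)) + ζ⁻¹ ^ ((k : ℕ) * (j : ℕ))) / 2 * x j =
        (a + b) / 2 := by
      rw [ha, hb, ← Finset.sum_add_distrib, Finset.sum_div]
      exact Finset.sum_congr rfl fun j _ => by ring
    have hle : ‖(a + b) / 2‖ ≤ (‖a‖ + ‖b‖) / 2 := by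
      rw [norm_div]
      have := norm_add_le a b
      norm_num
      linarith
    rw [hab]
    nlinarith [norm_nonneg ((a + b) / 2), norm_nonneg a, norm_nonneg b, sq_nonneg (‖a‖ - ‖b‖),
      pow_le_pow_left₀ (norm_nonneg _) hle 2]
  refine (Finset.sum_le_sum fun k _ => hk k).trans ?_
  rw [← Finset.sum_div, Finset.sum_add_distrib, h1, h2]
  linarith

/-- The squared norm passes to the summands, as at most one `l` satisfies `j + l = t`. -/
theorem norm_sq_sum_shift {T : ℕ} (u : Fin T → ℂ) (j t : ℕ) :
    ‖∑ l : Fin T, if j + (l : ℕ) = t then u l else 0‖ ^ 2 =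
      ∑ l : Fin T, if j + (l : ℕ) = t then ‖u l‖ ^ 2 else 0 := by
  by_cases h : ∃ l : Fin T, j + (l : ℕ) = t
  · obtain ⟨l, rfl⟩ := h
    have : ∀ l' : Fin T, j + (l' : ℕ) = j + (l : ℕ) ↔ l' = l := fun l' => by
      rw [Nat.add_left_cancel_iff, Fin.ext_iff]
    simp only [this, Finset.sum_ite_eq', Finset.mem_univ, if_true]
  · push Not at h
    simp [h]

theorem conv_eq_sum_mul {r T : ℕ} (g : Fin r → ℂ) (u : Fin T → ℂ) (t : Fin T) :
    conv g u t = ∑ j : Fin r, g j * ∑ l : Fin T, if (j : ℕ) + (l : ℕ) = t then u l else 0 := by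
  simp only [conv, Finset.mul_sum, mul_ite, mul_zero]

/-- On average over the frequencies, the output energy of a cosine filter is at most `r` times the
input energy. -/
theorem sum_norm_sq_conv_cosFilter_le {r T : ℕ} (hr : r ≠ 0) (u : Fin T → ℂ) :
    ∑ k : Fin r, ∑ t, ‖conv (ofRealFilter (cosFilter r k)) u t‖ ^ 2 ≤
      (r : ℝ) ^ 2 * ∑ l, ‖u l‖ ^ 2 := by
  rw [Finset.sum_comm]
  calc ∑ t, ∑ k : Fin r, ‖conv (ofRealFilter (cosFilter r k)) u t‖ ^ 2
      ≤ ∑ t : Fin T, r * ∑ j : Fin r, ∑ l : Fin T,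
          if (j : ℕ) + (l : ℕ) = t then ‖u l‖ ^ 2 else 0 := by
        -- For fixed `t` the output is the cosine transform of `j ↦ u (t - j)`, extended by zero.
        refine Finset.sum_le_sum fun t _ => ?_
        simp_rw [conv_eq_sum_mul, ← norm_sq_sum_shift]
        exact sum_norm_sq_cosFilter_le hr _
    _ = r * ∑ j : Fin r, ∑ l : Fin T, ∑ t : Fin T,
          if (j : ℕ) + (l : ℕ) = t then ‖u l‖ ^ 2 else 0 := by
        rw [← Finset.mul_sum, Finset.sum_comm]
        congr 1
        exact Finset.sum_congr rfl fun j _ => Finset.sum_comm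
    _ ≤ r * ∑ _j : Fin r, ∑ l : Fin T, ‖u l‖ ^ 2 := by
        gcongr with j _ l _
        rw [← Finset.sum_filter, Finset.sum_const]
        have hcard : (Finset.univ.filter fun t : Fin T => (j : ℕ) + (l : ℕ) = t).card ≤ 1 := by
          rw [Finset.card_le_one]
          intro a ha b hb
          simp only [Finset.mem_filter, Finset.mem_univ, true_and] at ha hb
          exact Fin.ext (by omega)
        rw [nsmul_eq_mul]
        exact mul_le_of_le_one_left (by positivity) (by exact_mod_cast hcard)
    _ = (r : ℝ) ^ 2 * ∑ l, ‖u l‖ ^ 2 := by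
        rw [Finset.sum_const, Finset.card_univ, Fintype.card_fin, nsmul_eq_mul]
        ring

/-! ### Transfer functions at roots of unity -/

theorem conv_ofReal {r T : ℕ} (g : Fin r → ℝ) (u : Fin T → ℝ) (t : Fin T) :
    conv (ofRealFilter g) (fun l => (u l : ℂ)) t = ((conv g u t : ℝ) : ℂ) := by
  simp only [conv, ofRealFilter, Complex.ofReal_sum]
  refine Finset.sum_congr rfl fun j _ => Finset.sum_congr rfl fun l _ => ?_
  split_ifs <;> simp

theorem conv_smul {R : Type*} [Semiring R] {r T : ℕ} (a : R) (g : Fin r → R) (u : Fin T → R)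
    (t : Fin T) : conv (a • g) u t = a * conv g u t := by
  simp [conv, Finset.mul_sum, mul_assoc]

theorem transfer_sub {r : ℕ} (g h : FIRFilter r) (z : ℂ) :
    transfer (g - h) z = transfer g z - transfer h z := by
  simp [transfer, sub_mul]

theorem measurable_transfer {r : ℕ} (z : ℂ) :
    Measurable fun g : FIRFilter r => transfer g z := by
  unfold transfer
  fun_prop

theorem enorm_transfer_le_hinfNorm {r : ℕ} (g : FIRFilter r) {z : ℂ} (hz : ‖z‖ = 1) :
    ‖transfer g z‖ₑ ≤ hinfNorm g :=
  le_iSup (fun z : Circle => ‖transfer g (z : ℂ)‖ₑ) ⟨z, mem_sphere_zero_iff_norm.2 hz⟩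

/-- The values of the cosine filters at the positive frequencies below the Nyquist frequency. -/
theorem transfer_cosFilter {r k l : ℕ} (hk : 0 < k) (hk' : 2 * k < r) (hl : 0 < l)
    (hl' : 2 * l < r) :
    transfer (ofRealFilter (cosFilter r l)) (Complex.exp (2 * Real.pi * Complex.I / r) ^ k) =
      if k = l then (r : ℂ) / 2 else 0 := by
  have hr : r ≠ 0 := by omega
  have hζ := Complex.isPrimitiveRoot_exp r hr
  simp only [transfer, ofRealFilter, cosFilter_eq hr]
  set ζ := Complex.exp (2 * Real.pi * Complex.I / r)
  have hζ0 : ζ ≠ 0 := hζ.ne_zero hr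
  have h : ∀ j : Fin r, (ζ ^ (l * (j : ℕ)) + ζ⁻¹ ^ (l * (j : ℕ))) / 2 * ((ζ ^ k) ^ (j : ℕ))⁻¹ =
      ((ζ ^ ((l : ℤ) - k)) ^ (j : ℕ) + (ζ ^ (-(l : ℤ) - k)) ^ (j : ℕ)) / 2 := by
    intro j
    rw [zpow_sub₀ hζ0, zpow_sub₀ hζ0, zpow_neg, zpow_natCast, zpow_natCast, div_pow, div_pow,
      pow_mul, pow_mul, inv_pow]
    ring
  simp_rw [h]
  rw [← Finset.sum_div, Finset.sum_add_distrib, sum_zpow_pow_of_isPrimitiveRoot hζ,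
    sum_zpow_pow_of_isPrimitiveRoot hζ]
  -- Below Nyquist `0 < k + l < r`, so the mirror frequency contributes nothing.
  have h1 : ¬ (r : ℤ) ∣ -(l : ℤ) - k := by
    intro hd
    have := Int.eq_zero_of_abs_lt_dvd hd (by rw [abs_lt]; omega)
    omega
  have h2 : (r : ℤ) ∣ (l : ℤ) - k ↔ k = l := by
    refine ⟨fun hd => ?_, fun hd => by simp [hd]⟩
    have := Int.eq_zero_of_abs_lt_dvd hd (by rw [abs_lt]; omega)
    omega
  simp only [h1, h2, if_false, add_zero]
  split_ifs <;> simp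

/-! ### Input energy and the choice of frequencies -/

/-- The energy of a vector of length `2 r` in the unit ball of `ℓ^p`. -/
theorem sum_norm_sq_le_of_lp_norm_le {E : Type*} [NormedAddCommGroup E] {p : ℝ≥0∞} (hp : 1 ≤ p)
    {r : ℕ} (hr : r ≠ 0) (u : Fin (2 * r) → E) (hu : ‖WithLp.toLp p u‖ ≤ 1) :
    ∑ t, ‖u t‖ ^ 2 ≤ 2 * (r : ℝ) ^ (1 - (2 / max p 2).toReal) := by
  have hr0 : (0 : ℝ) < r := by exact_mod_cast Nat.pos_of_ne_zero hr
  rcases eq_or_ne p ∞ with rfl | hptop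
  · have hle : ∀ t, ‖u t‖ ≤ 1 := fun t => by
      rw [PiLp.norm_eq_ciSup] at hu
      exact (le_ciSup (f := fun i => ‖u i‖) (Set.finite_range _).bddAbove t).trans hu
    calc ∑ t, ‖u t‖ ^ 2 ≤ ∑ _t : Fin (2 * r), (1 : ℝ) :=
          Finset.sum_le_sum fun t _ => pow_le_one₀ (norm_nonneg _) (hle t)
      _ = _ := by simp
  have hq : 1 ≤ p.toReal := by
    simpa using ENNReal.toReal_mono hptop hp
  set q := p.toReal with hqdef
  have hsum : ∑ t, ‖u t‖ ^ q ≤ 1 := by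
    rw [PiLp.norm_eq_sum (by linarith)] at hu
    by_contra! hlt
    exact absurd hu (not_le.2 (Real.one_lt_rpow hlt (by positivity)))
  rcases le_or_gt p 2 with hp2 | hp2
  · have hq2 : q ≤ 2 := by simpa using ENNReal.toReal_mono (by simp) hp2
    have hle : ∀ t, ‖u t‖ ≤ 1 := fun t => by
      by_contra! hlt
      have h1 : ‖u t‖ ^ q ≤ ∑ t, ‖u t‖ ^ q :=
        Finset.single_le_sum (f := fun t => ‖u t‖ ^ q) (fun i _ => by positivity)
          (Finset.mem_univ t)
      exact absurd (h1.trans hsum) (not_le.2 (Real.one_lt_rpow hlt (by linarith)))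
    have h2 : ∑ t, ‖u t‖ ^ 2 ≤ ∑ t, ‖u t‖ ^ q := by
      refine Finset.sum_le_sum fun t _ => ?_
      rw [← Real.rpow_two]
      exact Real.rpow_le_rpow_of_exponent_ge' (norm_nonneg _) (hle t) (by linarith) hq2
    rw [max_eq_right hp2, ENNReal.div_self (by simp) (by simp)]
    simp only [ENNReal.toReal_one, sub_self, Real.rpow_zero]
    linarith
  · have hq2 : 2 < q := by
      simpa using (ENNReal.toReal_lt_toReal (by simp) hptop).2 hp2
    have hs : (2 / max p 2).toReal = 2 / q := by
      rw [max_eq_left hp2.le, ENNReal.toReal_div]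
      simp [hqdef]
    rw [hs]
    -- Power-mean inequality for the squares `‖u t‖ ^ 2`, with exponent `q / 2 > 1`.
    have h1 := Real.rpow_sum_le_const_mul_sum_rpow_of_nonneg (s := Finset.univ) (p := q / 2)
      (f := fun t => ‖u t‖ ^ 2) (by linarith) (fun t _ => by positivity)
    have h2 : ∀ t, (‖u t‖ ^ 2) ^ (q / 2) = ‖u t‖ ^ q := fun t => by
      rw [← Real.rpow_two, ← Real.rpow_mul (norm_nonneg _)]
      congr 1
      ring
    simp only [h2, Finset.card_univ, Fintype.card_fin] at h1
    push_cast at h1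
    have h3 : (∑ t, ‖u t‖ ^ 2) ^ (q / 2) ≤ (2 * (r : ℝ)) ^ (q / 2 - 1) :=
      h1.trans (mul_le_of_le_one_right (by positivity) hsum)
    have h4 := Real.rpow_le_rpow (by positivity) h3 (z := 2 / q) (by positivity)
    rw [← Real.rpow_mul (by positivity), ← Real.rpow_mul (by positivity),
      show q / 2 * (2 / q) = 1 by field_simp, Real.rpow_one,
      show (q / 2 - 1) * (2 / q) = 1 - 2 / q by field_simp] at h4
    refine h4.trans ?_
    rw [Real.mul_rpow (by norm_num) hr0.le]
    gcongr
    calc (2 : ℝ) ^ (1 - 2 / q) ≤ 2 ^ (1 : ℝ) :=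
          Real.rpow_le_rpow_of_exponent_le (by norm_num) (by linarith [show 0 < 2 / q by positivity])
      _ = 2 := Real.rpow_one 2

/-- There are many frequencies at which the output energy of the cosine filter is not much larger
than on average. -/
theorem exists_frequencies_energy_le {r m T : ℕ} (hr : 16 ≤ r) (hm : 1 ≤ m)
    (u : Fin m → Fin T → ℂ) {V : ℝ} (hV : 0 < V) (hu : ∀ i, ∑ t, ‖u i t‖ ^ 2 ≤ V) :
    ∃ S : Finset ℕ, 5 * r ≤ 16 * S.card ∧ ∀ k ∈ S, 0 < k ∧ 2 * k < r ∧
      ∑ i, ∑ t, ‖conv (ofRealFilter (cosFilter r k)) (u i) t‖ ^ 2 ≤ 8 * r * m * V := by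
  have hr0 : (0 : ℝ) < r := by exact_mod_cast (by omega : 0 < r)
  have hm0 : (0 : ℝ) < m := by exact_mod_cast (by omega : 0 < m)
  set E : ℕ → ℝ := fun k => ∑ i, ∑ t, ‖conv (ofRealFilter (cosFilter r k)) (u i) t‖ ^ 2 with hE
  have hE0 : ∀ k, 0 ≤ E k := fun k => by positivity
  have htot : ∑ k ∈ Finset.range r, E k ≤ (r : ℝ) ^ 2 * m * V := by
    rw [Finset.sum_range, hE]
    simp only
    rw [Finset.sum_comm]
    calc ∑ i, ∑ k : Fin r, ∑ t, ‖conv (ofRealFilter (cosFilter r k)) (u i) t‖ ^ 2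
        ≤ ∑ _i : Fin m, (r : ℝ) ^ 2 * V := by
          refine Finset.sum_le_sum fun i _ =>
            (sum_norm_sq_conv_cosFilter_le (by omega) (u i)).trans ?_
          gcongr
          exact hu i
      _ = (r : ℝ) ^ 2 * m * V := by
          rw [Finset.sum_const, Finset.card_univ, Fintype.card_fin, nsmul_eq_mul]
          ring
  -- With truncated division, these are exactly the `k` with `0 < k` and `2 * k < r`, for either
  -- parity of `r`.
  set F := Finset.Ioo 0 ((r + 1) / 2) with hF
  set bad := F.filter fun k => ¬ E k ≤ 8 * r * m * V with hbad
  have hsub : bad ⊆ Finset.range r := fun k hk => by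
    simp only [hbad, hF, Finset.mem_filter, Finset.mem_Ioo] at hk
    rw [Finset.mem_range]
    omega
  -- Markov: the threshold is eight times the average of the total bound over `r` frequencies.
  have hbadcard : 8 * bad.card ≤ r := by
    have h1 : (bad.card : ℝ) * (8 * r * m * V) ≤ (r : ℝ) ^ 2 * m * V := by
      calc (bad.card : ℝ) * (8 * r * m * V) = ∑ _k ∈ bad, 8 * r * m * V := by
            rw [Finset.sum_const, nsmul_eq_mul]
        _ ≤ ∑ k ∈ bad, E k := Finset.sum_le_sum fun k hk =>
            (not_le.1 (Finset.mem_filter.1 hk).2).le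
        _ ≤ ∑ k ∈ Finset.range r, E k :=
            Finset.sum_le_sum_of_subset_of_nonneg hsub fun k _ _ => hE0 k
        _ ≤ _ := htot
    have h2 : (8 * bad.card : ℝ) ≤ r := by
      refine le_of_mul_le_mul_right ?_ (show 0 < (r : ℝ) * m * V by positivity)
      calc (8 * bad.card : ℝ) * (r * m * V) = bad.card * (8 * r * m * V) := by ring
        _ ≤ _ := h1
        _ = r * (r * m * V) := by ring
    exact_mod_cast h2
  have hcard : (F.filter fun k => E k ≤ 8 * r * m * V).card + bad.card = (r + 1) / 2 - 0 - 1 := by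
    rw [Finset.card_filter_add_card_filter_not, hF, Nat.card_Ioo]
  -- The count is at least `r/2 - 1 - r/8`, and `r/2 - 1 ≥ 7r/16` because `r ≥ 16`.
  refine ⟨F.filter fun k => E k ≤ 8 * r * m * V, by omega, fun k hk => ?_⟩
  simp only [hF, Finset.mem_filter, Finset.mem_Ioo] at hk
  exact ⟨by omega, by omega, hk.2⟩

/-! ### The minimax lower bound -/

theorem ofRealFilter_smul {r : ℕ} (a : ℝ) (g : Fin r → ℝ) :
    ofRealFilter (a • g) = (a : ℂ) • ofRealFilter g := by
  ext j
  simp [ofRealFilter]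

theorem transfer_smul {r : ℕ} (a : ℂ) (g : FIRFilter r) (z : ℂ) :
    transfer (a • g) z = a * transfer g z := by
  simp [transfer, Finset.mul_sum, mul_assoc]

/-- The risk of an estimator is large at one of the cosine filters, if the laws of the data at
these filters are dominated by a common law. -/
theorem exists_cosFilter_risk_ge {Ω : Type*} [MeasurableSpace Ω] {r : ℕ} (S : Finset ℕ)
    (hS : S.Nonempty) (hfreq : ∀ k ∈ S, 0 < k ∧ 2 * k < r) {a : ℝ} (ha : 0 ≤ a)
    (P : ℕ → Measure Ω) [∀ k, IsProbabilityMeasure (P k)] (Q : Measure Ω)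
    [IsProbabilityMeasure Q] {K : ℝ≥0∞} (hP : ∀ k ∈ S, SqDominated K (P k) Q)
    (hK : 16 * K ≤ 9 * S.card) {Ghat : Ω → FIRFilter r} (hG : Measurable Ghat) :
    ∃ k ∈ S, ENNReal.ofReal (a * r / 16) ≤
      ∫⁻ Y, hinfNorm (Ghat Y - ofRealFilter (a • cosFilter r k)) ∂(P k) := by
  obtain ⟨k₀, hk₀⟩ := hS
  have hr : r ≠ 0 := by have := hfreq k₀ hk₀; omega
  set ζ := Complex.exp (2 * Real.pi * Complex.I / r) with hζdef
  have hζ : ‖ζ‖ = 1 := (Complex.isPrimitiveRoot_exp r hr).norm'_eq_one hr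
  set d : ℕ → ℕ → Ω → ℝ := fun k l Y =>
    ‖transfer (Ghat Y - ofRealFilter (a • cosFilter r k)) (ζ ^ l)‖ with hd
  have hdm : ∀ k l, Measurable (d k l) := fun k l =>
    ((measurable_transfer (ζ ^ l)).comp (hG.sub_const _)).norm
  -- Closeness is tested only at finitely many roots of unity: this makes the events measurable and
  -- still bounds the `H∞` error from below.
  set B : ℕ → Set Ω := fun k => ⋂ l ∈ S, {Y | d k l Y < a * r / 4} with hBdef
  have hB : ∀ k, MeasurableSet (B k) := fun k =>
    S.measurableSet_biInter fun l _ => measurableSet_lt (hdm k l) measurable_const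
  have hdisj : (S : Set ℕ).PairwiseDisjoint B := by
    intro k hk l hl hkl
    refine Set.disjoint_left.2 fun Y hY hY' => ?_
    simp only [hBdef, Set.mem_iInter, Set.mem_ofPred_eq] at hY hY'
    have h1 := hY k hk
    have h2 := hY' k hk
    -- At `ζ ^ k` the two candidate filters differ by `a r / 2`, so both errors cannot be below half
    -- of that.
    have h3 : a * r / 2 ≤ d k k Y + d l k Y := by
      have e : ((a * r / 2 : ℝ) : ℂ) =
          transfer (Ghat Y - ofRealFilter (a • cosFilter r l)) (ζ ^ k) -
          transfer (Ghat Y - ofRealFilter (a • cosFilter r k)) (ζ ^ k) := by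
        rw [transfer_sub, transfer_sub, ofRealFilter_smul, ofRealFilter_smul, transfer_smul,
          transfer_smul, transfer_cosFilter (hfreq k hk).1 (hfreq k hk).2 (hfreq l hl).1
          (hfreq l hl).2, transfer_cosFilter (hfreq k hk).1 (hfreq k hk).2 (hfreq k hk).1
          (hfreq k hk).2, if_neg hkl, if_pos rfl]
        push_cast
        ring
      have h4 := norm_sub_le (transfer (Ghat Y - ofRealFilter (a • cosFilter r l)) (ζ ^ k))
          (transfer (Ghat Y - ofRealFilter (a • cosFilter r k)) (ζ ^ k))
      rw [← e, Complex.norm_real, Real.norm_of_nonneg (by positivity)] at h4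
      linarith
    linarith
  obtain ⟨k, hk, hPk⟩ :=
    exists_measure_le_of_sqDominated S P Q hP (fun k _ => hB k) hdisj ⟨k₀, hk₀⟩ hK
  refine ⟨k, hk, ?_⟩
  have h := mul_le_lintegral_of_measure_le (P k) (hB k) hPk (δ := ENNReal.ofReal (a * r / 4))
    (d := fun Y => hinfNorm (Ghat Y - ofRealFilter (a • cosFilter r k))) (by
      intro Y hY
      simp only [hBdef, Set.mem_iInter, Set.mem_ofPred_eq, not_forall, not_lt] at hY
      obtain ⟨l, _, hle⟩ := hY
      refine le_trans ?_ (enorm_transfer_le_hinfNorm _ (z := ζ ^ l) (by simp [hζ]))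
      rw [← ofReal_norm]
      exact ENNReal.ofReal_le_ofReal hle)
  refine le_trans (le_of_eq ?_) h
  rw [show a * r / 16 = a * r / 4 * 4⁻¹ by ring, ENNReal.ofReal_mul (by positivity),
    ENNReal.ofReal_inv_of_pos (by norm_num)]
  norm_num

/-- With `y = r^(1/4) ≥ 2` one has `8y ≤ y⁴ = r`, so `16y ≤ 2r ≤ 45r/16 ≤ 9n`. -/
theorem exp_log_quarter_le {r n : ℕ} (hr : 16 ≤ r) (hn : 5 * r ≤ 16 * n) :
    16 * ENNReal.ofReal (Real.exp (Real.log r / 4)) ≤ 9 * (n : ℝ≥0∞) := by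
  have hr' : (16 : ℝ) ≤ r := by exact_mod_cast hr
  have hn' : (5 * r : ℝ) ≤ 16 * n := by exact_mod_cast hn
  set y := Real.exp (Real.log r / 4) with hy
  have hy0 : 0 < y := Real.exp_pos _
  have hy4 : y ^ 4 = r := by
    rw [hy, ← Real.exp_nat_mul]
    push_cast
    rw [mul_div_cancel₀ _ (by norm_num), Real.exp_log (by linarith)]
  have hy2 : 2 ≤ y := by
    by_contra! hlt
    have := pow_lt_pow_left₀ hlt hy0.le (n := 4) (by norm_num)
    linarith
  have hy3 : 8 * y ≤ r := by
    have h8 : (2 : ℝ) ^ 3 ≤ y ^ 3 := pow_le_pow_left₀ (by norm_num) hy2 3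
    rw [← hy4]
    nlinarith
  have key : 16 * y ≤ 9 * n := by linarith
  have := ENNReal.ofReal_le_ofReal key
  rwa [ENNReal.ofReal_mul (by norm_num), ENNReal.ofReal_mul (by norm_num), ENNReal.ofReal_natCast,
    ENNReal.ofReal_ofNat, ENNReal.ofReal_ofNat] at this

/-- At the amplitude `rate / (8 r)`, the energy bound of the cosine filters is `σ² log r / 4`. -/
theorem amplitude_sq_mul_energy (p : ℝ≥0∞) {σ : ℝ≥0} (hσ : σ ≠ 0) {r m : ℕ} (hr : 16 ≤ r)
    (hm : 1 ≤ m) :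
    (rate p σ r m / (8 * r)) ^ 2 *
      (8 * r * m * (2 * (r : ℝ) ^ (1 - (2 / max p 2).toReal))) / σ ^ 2 = Real.log r / 4 := by
  have hr0 : (0 : ℝ) < r := by exact_mod_cast (by omega : 0 < r)
  have hm0 : (0 : ℝ) < m := by exact_mod_cast (by omega : 0 < m)
  have hσ0 : (σ : ℝ) ≠ 0 := by exact_mod_cast hσ
  have hlog : 0 ≤ Real.log r := Real.log_natCast_nonneg r
  rw [rate]
  generalize (2 / max p 2).toReal = s
  have hs : (r : ℝ) ^ s ≠ 0 := (Real.rpow_pos_of_pos hr0 s).ne'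
  rw [div_pow, mul_pow, Real.sq_sqrt (by positivity), Real.rpow_sub hr0, Real.rpow_one]
  field_simp
  ring

theorem rate_nonneg (p : ℝ≥0∞) (σ : ℝ≥0) (r m : ℕ) : 0 ≤ rate p σ r m :=
  mul_nonneg σ.coe_nonneg (Real.sqrt_nonneg _)

theorem rate_le_realMinimaxRisk {p : ℝ≥0∞} (hp : 1 ≤ p) {r m : ℕ} (hr : 16 ≤ r) (hm : 1 ≤ m)
    {σ : ℝ≥0} (hσ : σ ≠ 0) (u : Fin m → Fin (2 * r) → ℝ)
    (hu : ∀ i, ‖WithLp.toLp p (u i)‖ ≤ 1) :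
    ENNReal.ofReal (1 / 128 * rate p σ r m) ≤ realMinimaxRisk r σ u := by
  have hr0 : (0 : ℝ) < r := by exact_mod_cast (by omega : 0 < r)
  obtain ⟨S, hcard, hS⟩ := exists_frequencies_energy_le hr hm (fun i t => (u i t : ℂ))
    (V := 2 * (r : ℝ) ^ (1 - (2 / max p 2).toReal)) (by positivity) (fun i => by
      simpa using sum_norm_sq_le_of_lp_norm_le hp (by omega) (u i) (hu i))
  refine le_iInf₂ fun Ghat hG => ?_
  -- The risk bound `a r / 16` then equals `rate / 128`.
  set a := rate p σ r m / (8 * r) with ha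
  obtain ⟨k, -, hk⟩ := exists_cosFilter_risk_ge S
    (Finset.card_pos.1 (by omega)) (fun k hk => ⟨(hS k hk).1, (hS k hk).2.1⟩)
    (a := a) (div_nonneg (rate_nonneg _ _ _ _) (by positivity))
    (fun k => realLaw σ u (a • cosFilter r k)) (realLaw σ u (0 : Fin r → ℝ))
    (fun k hk => (sqDominated_realLaw hσ u (a • cosFilter r k)).mono (by
      rw [← amplitude_sq_mul_energy p hσ hr hm]
      gcongr
      simp only [conv_smul, norm_mul, mul_pow, ← Finset.mul_sum, Real.norm_eq_abs a, sq_abs]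
      gcongr
      simpa only [conv_ofReal, Complex.norm_real] using (hS k hk).2.2))
    (exp_log_quarter_le hr hcard) hG
  refine le_trans (le_of_eq ?_) (hk.trans (le_iSup (fun g : Fin r → ℝ =>
    ∫⁻ Y, hinfNorm (Ghat Y - ofRealFilter g) ∂(realLaw σ u g)) (a • cosFilter r k)))
  rw [ha]
  congr 1
  field_simp
  ring

/-- The same real cosine filters serve as hard instances, since complex noise of variance `σ²` per
real component gives the same second-moment bound. -/
theorem rate_le_complexMinimaxRisk {p : ℝ≥0∞} (hp : 1 ≤ p) {r m : ℕ} (hr : 16 ≤ r) (hm : 1 ≤ m)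
    {σ : ℝ≥0} (hσ : σ ≠ 0) (u : Fin m → Fin (2 * r) → ℂ)
    (hu : ∀ i, ‖WithLp.toLp p (u i)‖ ≤ 1) :
    ENNReal.ofReal (1 / 128 * rate p σ r m) ≤ complexMinimaxRisk r σ u := by
  have hr0 : (0 : ℝ) < r := by exact_mod_cast (by omega : 0 < r)
  obtain ⟨S, hcard, hS⟩ := exists_frequencies_energy_le hr hm u
    (V := 2 * (r : ℝ) ^ (1 - (2 / max p 2).toReal)) (by positivity) (fun i =>
      sum_norm_sq_le_of_lp_norm_le hp (by omega) (u i) (hu i))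
  refine le_iInf₂ fun Ghat hG => ?_
  set a := rate p σ r m / (8 * r) with ha
  obtain ⟨k, -, hk⟩ := exists_cosFilter_risk_ge S
    (Finset.card_pos.1 (by omega)) (fun k hk => ⟨(hS k hk).1, (hS k hk).2.1⟩)
    (a := a) (div_nonneg (rate_nonneg _ _ _ _) (by positivity))
    (fun k => complexLaw σ u (ofRealFilter (a • cosFilter r k)))
    (complexLaw σ u (0 : FIRFilter r))
    (fun k hk => (sqDominated_complexLaw hσ u (ofRealFilter (a • cosFilter r k))).mono (by
      rw [← amplitude_sq_mul_energy p hσ hr hm]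
      gcongr
      simp only [ofRealFilter_smul, conv_smul, norm_mul, mul_pow, ← Finset.mul_sum,
        Complex.norm_real, Real.norm_eq_abs a, sq_abs]
      gcongr
      exact (hS k hk).2.2))
    (exp_log_quarter_le hr hcard) hG
  refine le_trans (le_of_eq ?_) (hk.trans (le_iSup (fun g : FIRFilter r =>
    ∫⁻ Y, hinfNorm (Ghat Y - g) ∂(complexLaw σ u g)) (ofRealFilter (a • cosFilter r k))))
  rw [ha]
  congr 1
  field_simp
  ring

end FIRIdent

theorem theorem3 :
    ∃ C : ℝ, 0 < C ∧
      ∀ (p : ℝ≥0∞) (_ : 1 ≤ p) (r : ℕ) (_ : 16 ≤ r) (m : ℕ) (_ : 1 ≤ m) (σ : ℝ≥0),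
        (∀ u : Fin m → Fin (2 * r) → ℝ, (∀ i, ‖WithLp.toLp p (u i)‖ ≤ 1) →
          ENNReal.ofReal (C * FIRIdent.rate p σ r m) ≤ FIRIdent.realMinimaxRisk r σ u) ∧
        (∀ u : Fin m → Fin (2 * r) → ℂ, (∀ i, ‖WithLp.toLp p (u i)‖ ≤ 1) →
          ENNReal.ofReal (C * FIRIdent.rate p σ r m) ≤
            FIRIdent.complexMinimaxRisk r σ u) := by
  refine ⟨1 / 128, by norm_num, fun p hp r hr m hm σ => ?_⟩
  rcases eq_or_ne σ 0 with rfl | hσ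
  -- Without noise the Gaussian laws have no densities, but the claimed bound is zero.
  · simp [FIRIdent.rate]
  · exact ⟨FIRIdent.rate_le_realMinimaxRisk hp hr hm hσ,
      FIRIdent.rate_le_complexMinimaxRisk hp hr hm hσ⟩
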